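/- All logarithms are to base 2. A binary linear code of length $N$ is an $\mathbb{F}_2$-linear subspace $C$ of $\{D\to\mathbb{F}_2\}$ with $|D|=N$; let $\delta(f,g)=|\{x\in D: f(x)\neq g(x)\}|/|D|$. The code $C$ is a $(q,\delta)$-LCC if there is a probabilistic oracle algorithm which, given $x\in D$ and oracle access to any $f:D\to\mathbb{F}_2$ with $\delta(f,g)\le\delta$ for some $g\in C$, makes at most $q$ queries to $f$ and outputs $g(x)$ with probability at least $2/3$. It is a $(q,\varepsilon,\delta)$-LTC if any two distinct codewords $g,g'$ satisfy $\delta(g,g')>\delta$ and there is a probabilistic oracle algorithm which makes at most $q$ queries to $f:D\to\mathbb{F}_2$, accepts every $f\in C$ with probability one, and, for every $\tau$, rejects with probability at least $\varepsilon\tau$ every $f$ such that $\delta(f,g)>\tau$ for all $g\in C$. **Theorem.** There is an absolute constant $c_0>0$ such that for every positive integer $t$ and $k=2^t$ there is a constant $c_k>0$ for which the following hold. (a) For every positive integer $m$ and $N=2^m$ there is a binary linear code of length $N$ and dimension at least $c_k(\log N)^{k-2}$ which is a $(k-1,\,k^{-1}/3)$-LCC and a $(k,\,c_0k^{-2},\,k^{-1})$-LTC.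 (b) For every positive integer $n$ and $N=k^n$, such a code (with the same constants $c_0$ and $c_k$) is the lift to $\mathbb{F}_k^n$ of the parity-check code on $\mathbb{F}_k$, that is, the code of all $f:\mathbb{F}_k^n\to\mathbb{F}_2$ with $\sum_{x\in\ell}f(x)=0$ for every affine line $\ell\subseteq\mathbb{F}_k^n$. -/

import Mathlib

/-- A deterministic (adaptive) oracle algorithm: it either outputs a value, or queries the oracle
at a point of `D` and continues depending on the answer, which is an element of `A`. -/
inductive QueryAlg (D A R : Type) : Type
  | output (r : R) : QueryAlg D A R
  | query (x : D) (next : A → QueryAlg D A R) : QueryAlg D A R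

namespace QueryAlg

variable {D A R : Type}

/-- The output of the algorithm when it is run with oracle `f`. -/
def run (f : D → A) : QueryAlg D A R → R
  | output r => r
  | query x next => (next (f x)).run f

/-- The number of queries that the algorithm makes when it is run with oracle `f`. -/
def numQueries (f : D → A) : QueryAlg D A R → ℕ
  | output _ => 0
  | query x next => (next (f x)).numQueries f + 1

end QueryAlg

/-- A probabilistic oracle algorithm: a probability distribution (the internal coin tosses) on
deterministic oracle algorithms. -/
abbrev RandQueryAlg (D A R : Type) : Type := PMF (QueryAlg D A R)

namespace RandQueryAlg

variable {D A R : Type}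

/-- On every oracle and for every outcome of the coin tosses, at most `k` queries are made. -/
def MakesAtMost (P : RandQueryAlg D A R) (k : ℕ) : Prop :=
  ∀ T ∈ P.support, ∀ f : D → A, T.numQueries f ≤ k

/-- The probability that the algorithm outputs `r` when it is run with oracle `f`. -/
noncomputable def outputProb (P : RandQueryAlg D A R) (f : D → A) (r : R) : ℝ :=
  ((PMF.map (QueryAlg.run f) P) r).toReal

end RandQueryAlg

section Codes

variable {D A : Type} [Fintype D] [DecidableEq A]

/-- Normalized Hamming distance. -/
noncomputable def relDist (f g : D → A) : ℝ := (hammingDist f g : ℝ) / (Fintype.card D : ℝ)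

/-- `f` is `τ`-far from the code `C`: no codeword is at distance at most `τ` from `f`. -/
def IsFarFrom (C : Set (D → A)) (τ : ℝ) (f : D → A) : Prop :=
  ∀ g ∈ C, τ < relDist f g

/-- `C` is a code of distance `δ`: distinct codewords are `δ`-far from each other. -/
def HasDistance (C : Set (D → A)) (δ : ℝ) : Prop :=
  ∀ f ∈ C, ∀ g ∈ C, f ≠ g → δ < relDist f g

/-- `C` is a `(k, δ)`-locally correctible code. -/
def IsLCC (C : Set (D → A)) (k : ℕ) (δ : ℝ) : Prop :=
  ∃ Corr : D → RandQueryAlg D A A,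
    (∀ x, (Corr x).MakesAtMost k) ∧
    ∀ (x : D) (f : D → A), ∀ g ∈ C, relDist f g ≤ δ → 2 / 3 ≤ (Corr x).outputProb f (g x)

/-- `C` is a `(k, ε, δ)`-locally testable code. The tester accepts by outputting `true`. -/
def IsLTC (C : Set (D → A)) (k : ℕ) (ε δ : ℝ) : Prop :=
  HasDistance C δ ∧
  ∃ Test : RandQueryAlg D A Bool,
    Test.MakesAtMost k ∧
    (∀ f ∈ C, Test.outputProb f true = 1) ∧
    ∀ (τ : ℝ) (f : D → A), IsFarFrom C τ f → ε * τ ≤ Test.outputProb f false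

end Codes

/-- The parity-check code: functions on `D` whose values sum to zero. -/
def parityCheckCode (F D : Type) [Field F] [Fintype D] : Submodule F (D → F) where
  carrier := {f | ∑ x, f x = 0}
  add_mem' := by
    intro f g hf hg
    simp only [Set.mem_ofPred_eq] at hf hg ⊢
    simp [Finset.sum_add_distrib, hf, hg]
  zero_mem' := by simp
  smul_mem' := by
    intro a f hf
    simp only [Set.mem_ofPred_eq] at hf ⊢
    simp [← Finset.mul_sum, hf]

/-- The lift to the `K`-vector space `V` of a linear code `B` on the `K`-vector space `U`: all
functions on `V` whose restriction to every affine subspace of dimension `dim U` lies in `B`.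
The subspace is identified with `U` by an arbitrary injective affine map onto it; for an
affine-invariant `B` the choice of the map is immaterial. -/
def liftCode (K : Type) [Field K] {F U : Type} [Field F] [AddCommGroup U] [Module K U]
    (V : Type) [AddCommGroup V] [Module K V] (B : Submodule F (U → F)) : Submodule F (V → F) where
  carrier := {f | ∀ φ : U →ᵃ[K] V, Function.Injective φ → (fun u => f (φ u)) ∈ B}
  add_mem' := fun hf hg φ hφ => B.add_mem (hf φ hφ) (hg φ hφ)
  zero_mem' := fun _ _ => B.zero_mem
  smul_mem' := fun a _ hf φ hφ => B.smul_mem a (hf φ hφ)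

/-! A line of `K^n` has `k` points, and a codeword sums to zero on it, so its value at `x` is the
sum of its values at the other `k - 1` points of any line through `x`. On a random line through `x`
each of these points is uniform. A union bound therefore makes this sum a corrector that errs with
probability at most `(k - 1) δ`, and applying it to two distinct codewords gives relative distance
at least `1 / (k - 1)`.

The tester sums `f` along a random line; let `ρ` be its rejection probability. Let `g x` be the
majority of the corrections of `f` at `x`. Summing `f` over a grid `x + a u + b v` by rows and by
columns shows that two independent corrections differ with probability at most `2 (k - 1) ρ`
(`uniformProb_lineCorrection_ne_lineCorrection_le`), so the majority is overwhelming when `ρ` is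
small. A skew grid over a given line then forces `g` to sum to zero there, and `f` is within `2 ρ`
of `g` (`exists_mem_liftCode_near`). If `ρ` is not small, the required rejection probability holds
trivially.

For the dimension, a polynomial over `K` of degree at most `k - 2` sums to zero on every line, and
so do its `F_2`-coordinates; multilinear monomials already give `n.choose (k - 2)`
(`choose_le_finrank_liftCode`).

Lengths `2 ^ m` that are not powers of `k` are reached by repeating each coordinate once for each
element of a group `R`. Every query then takes its own random element of `R`, and the same arguments
apply on `V × R`. -/

open Finset

/-! ### Probabilities over a uniformly distributed seed -/

open Classical in
/-- The probability that a uniformly distributed element of `Ω` satisfies `p`. -/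
noncomputable def uniformProb {Ω : Type} [Fintype Ω] (p : Ω → Prop) : ℝ :=
  (#{ω | p ω} : ℝ) / (Fintype.card Ω : ℝ)

section UniformProb

variable {Ω Ω' : Type} [Fintype Ω] [Fintype Ω']

open Classical in
theorem uniformProb_eq_sum (p : Ω → Prop) :
    uniformProb p = (∑ ω, if p ω then (1 : ℝ) else 0) / (Fintype.card Ω : ℝ) := by
  simp [uniformProb]

theorem uniformProb_nonneg (p : Ω → Prop) : 0 ≤ uniformProb p := by
  unfold uniformProb; positivity

theorem uniformProb_mono {p q : Ω → Prop} (h : ∀ ω, p ω → q ω) :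
    uniformProb p ≤ uniformProb q := by
  classical
  unfold uniformProb
  gcongr with ω
  exact h ω

theorem uniformProb_le_one (p : Ω → Prop) : uniformProb p ≤ 1 := by
  classical
  unfold uniformProb
  refine div_le_one_of_le₀ ?_ (by positivity)
  exact_mod_cast card_le_univ _

theorem uniformProb_not [Nonempty Ω] (p : Ω → Prop) :
    uniformProb (fun ω => ¬ p ω) = 1 - uniformProb p := by
  classical
  have h0 : (Fintype.card Ω : ℝ) ≠ 0 := by exact_mod_cast Fintype.card_ne_zero
  unfold uniformProb
  rw [eq_sub_iff_add_eq, ← add_div, div_eq_one_iff_eq h0]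
  have := Finset.card_filter_add_card_filter_not (s := (univ : Finset Ω)) p
  rw [add_comm, ← Nat.cast_add, ← card_univ, ← this]
  congr!

theorem uniformProb_true [Nonempty Ω] {p : Ω → Prop} (h : ∀ ω, p ω) : uniformProb p = 1 := by
  have h0 : (Fintype.card Ω : ℝ) ≠ 0 := by exact_mod_cast Fintype.card_ne_zero
  simp [uniformProb, h, h0]

theorem exists_of_uniformProb_not_lt_one [Nonempty Ω] {p : Ω → Prop}
    (h : uniformProb (fun ω => ¬ p ω) < 1) : ∃ ω, p ω := by
  by_contra! H
  exact h.ne (uniformProb_true H)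

theorem uniformProb_le_sum {ι : Type} (s : Finset ι) {p : Ω → Prop} {q : ι → Ω → Prop}
    (h : ∀ ω, p ω → ∃ i ∈ s, q i ω) : uniformProb p ≤ ∑ i ∈ s, uniformProb (q i) := by
  classical
  unfold uniformProb
  rw [← sum_div]
  gcongr
  norm_cast
  refine le_trans (card_le_card fun ω hω => ?_) card_biUnion_le
  simpa using h ω (by simpa using hω)

theorem uniformProb_or_le (p q : Ω → Prop) :
    uniformProb (fun ω => p ω ∨ q ω) ≤ uniformProb p + uniformProb q := by
  classical
  unfold uniformProb
  rw [← add_div]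
  gcongr
  norm_cast
  refine le_trans (card_le_card fun ω hω => ?_) (card_union_le _ _)
  simpa using hω

theorem uniformProb_prod (p : Ω × Ω' → Prop) :
    uniformProb p = (∑ ω, uniformProb (fun ω' => p (ω, ω'))) / (Fintype.card Ω : ℝ) := by
  classical
  simp only [uniformProb_eq_sum, Fintype.sum_prod_type, Fintype.card_prod, Nat.cast_mul, ← sum_div,
    div_div, mul_comm]

theorem uniformProb_comp_equiv (e : Ω ≃ Ω') (p : Ω' → Prop) :
    uniformProb (fun ω => p (e ω)) = uniformProb p := by
  classical
  rw [uniformProb_eq_sum, uniformProb_eq_sum, Fintype.card_congr e,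
    e.sum_comp (fun ω => if p ω then (1 : ℝ) else 0)]

theorem uniformProb_comp_fst [Nonempty Ω'] (p : Ω → Prop) :
    uniformProb (fun ω : Ω × Ω' => p ω.1) = uniformProb p := by
  classical
  have h0 : (Fintype.card Ω' : ℝ) ≠ 0 := by exact_mod_cast Fintype.card_ne_zero
  rw [uniformProb_prod, uniformProb_eq_sum p]
  congr 1
  refine sum_congr rfl fun ω _ => ?_
  by_cases h : p ω <;> simp [uniformProb, h, h0]

/-- A surjective affine map between finite abelian groups maps the uniform distribution to the
uniform distribution. -/
theorem uniformProb_comp_affine {G H : Type} [Fintype G] [Fintype H] [AddCommGroup G]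
    [AddCommGroup H] (ψ : G → H) (hadd : ∀ x y, ψ (x + y) + ψ 0 = ψ x + ψ y)
    (hsurj : Function.Surjective ψ) (p : H → Prop) :
    uniformProb (fun g => p (ψ g)) = uniformProb p := by
  classical
  -- Removing the constant term leaves a homomorphism, whose nonempty fibres all have the same size.
  let φ : G →+ H := AddMonoidHom.mk' (fun g => ψ g - ψ 0) fun x y => by
    rw [eq_sub_of_add_eq (hadd x y)]; abel
  have hφ : ∀ h, h ∈ Set.range φ := fun h => by
    obtain ⟨g, hg⟩ := hsurj (h + ψ 0)
    exact ⟨g, by simp [φ, hg]⟩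
  have hfib : ∀ h, #{g | ψ g = h} = #{g | ψ g = ψ 0} := fun h => by
    have := AddMonoidHom.card_fiber_eq_of_mem_range φ (hφ (h - ψ 0)) (hφ 0)
    simpa [φ, sub_eq_zero] using this
  have hfib0 : (#{g | ψ g = ψ 0} : ℝ) ≠ 0 := by
    have : 0 < #{g | ψ g = ψ 0} := card_pos.2 ⟨0, by simp⟩
    positivity
  have hcount : ∀ q : H → Prop, #{g | q (ψ g)} = #{h | q h} * #{g | ψ g = ψ 0} := fun q => by
    rw [card_eq_sum_card_fiberwise (f := ψ) (t := {h | q h}) (fun g hg => by simpa using hg),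
      ← smul_eq_mul, ← sum_const]
    refine sum_congr rfl fun h hh => ?_
    rw [← hfib h, filter_filter]
    congr 1
    ext g
    simp only [mem_filter, mem_univ, true_and] at hh ⊢
    constructor
    · exact fun H => H.2
    · rintro rfl; exact ⟨hh, rfl⟩
  have hcard : Fintype.card G = Fintype.card H * #{g | ψ g = ψ 0} := by
    simpa using hcount fun _ => True
  unfold uniformProb
  rw [hcount p, hcard]
  push_cast
  exact mul_div_mul_right _ _ hfib0

/-- Take `b` to be a majority value. Whatever value the first of two independent draws has, the
second differs from it with at least the probability of the minority value; averaging over the first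
draw gives the second bound. -/
theorem exists_majority [Nonempty Ω] (h : Ω → ZMod 2) :
    ∃ b, uniformProb (fun ω => h ω ≠ b) ≤ 1 / 2 ∧
      uniformProb (fun ω => h ω ≠ b) ≤ uniformProb (fun ω : Ω × Ω => h ω.1 ≠ h ω.2) := by
  have key : ∀ b c : ZMod 2, b ≠ c → uniformProb (fun ω => h ω ≠ b) ≤ 1 / 2 →
      uniformProb (fun ω => h ω ≠ b) ≤ uniformProb (fun ω => h ω ≠ c) := fun b c hbc hb => by
    have : uniformProb (fun ω => h ω ≠ c) = 1 - uniformProb (fun ω => h ω ≠ b) := by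
      rw [← uniformProb_not]
      congr 1
      ext ω
      generalize h ω = d
      clear hb
      revert b c d
      decide
    linarith
  have hex : ∃ b, uniformProb (fun ω => h ω ≠ b) ≤ 1 / 2 := by
    by_contra! H
    have h0 := H 0
    have h1 := H 1
    have : uniformProb (fun ω => h ω ≠ 1) = 1 - uniformProb (fun ω => h ω ≠ 0) := by
      rw [← uniformProb_not]
      congr 1
      ext ω
      generalize h ω = d
      revert d
      decide
    linarith
  obtain ⟨b, hb⟩ := hex
  refine ⟨b, hb, ?_⟩
  have hpos : (0 : ℝ) < Fintype.card Ω := by exact_mod_cast Fintype.card_pos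
  rw [uniformProb_prod, le_div_iff₀ hpos, mul_comm, ← nsmul_eq_mul, ← card_univ, ← sum_const]
  refine sum_le_sum fun ω _ => ?_
  rcases eq_or_ne b (h ω) with hω | hω
  · simp only [hω, ne_comm]; exact le_rfl
  · simpa only [ne_comm] using key b (h ω) hω hb

end UniformProb

/-! ### Nonadaptive algorithms that read a sum -/

namespace QueryAlg

variable {D A R : Type} [AddCommMonoid A]

/-- Query the points of a list, and output a function of the sum of the answers. -/
def querySum (out : A → R) : List D → A → QueryAlg D A R
  | [], acc => output (out acc)
  | x :: l, acc => query x fun b => querySum out l (acc + b)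

theorem run_querySum (out : A → R) (f : D → A) (l : List D) (acc : A) :
    (querySum out l acc).run f = out (acc + (l.map f).sum) := by
  induction l generalizing acc with
  | nil => simp [querySum, run]
  | cons x l ih => simp [querySum, run, ih, add_assoc]

theorem numQueries_querySum (out : A → R) (f : D → A) (l : List D) (acc : A) :
    (querySum out l acc).numQueries f = l.length := by
  induction l generalizing acc with
  | nil => simp [querySum, numQueries]
  | cons x l ih => simp [querySum, numQueries, ih]

end QueryAlg

namespace RandQueryAlg

variable {D A R Ω ι : Type} [AddCommMonoid A] [Fintype Ω] [Nonempty Ω]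

/-- Draw a seed `ω`, query the points `pt ω i` for `i ∈ s`, and output a function of the sum of the
answers. -/
noncomputable def querySum (s : Finset ι) (pt : Ω → ι → D) (out : A → R) : RandQueryAlg D A R :=
  (PMF.uniformOfFintype Ω).map fun ω => QueryAlg.querySum out (s.toList.map (pt ω)) 0

theorem makesAtMost_querySum (s : Finset ι) (pt : Ω → ι → D) (out : A → R) :
    (querySum s pt out).MakesAtMost #s := by
  intro T hT f
  rw [querySum, PMF.mem_support_map_iff] at hT
  obtain ⟨ω, -, rfl⟩ := hT
  simp [QueryAlg.numQueries_querySum]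

theorem outputProb_querySum (s : Finset ι) (pt : Ω → ι → D) (out : A → R) (f : D → A) (r : R) :
    (querySum s pt out).outputProb f r = uniformProb fun ω => out (∑ i ∈ s, f (pt ω i)) = r := by
  classical
  have hrun : ∀ ω, QueryAlg.run f (QueryAlg.querySum out (s.toList.map (pt ω)) 0)
      = out (∑ i ∈ s, f (pt ω i)) := fun ω => by
    rw [QueryAlg.run_querySum, zero_add, List.map_map]
    congr 1
    exact Finset.sum_map_toList s _
  rw [outputProb, querySum, PMF.map_comp, PMF.map_apply, tsum_fintype]
  simp only [Function.comp, hrun, PMF.uniformOfFintype_apply, @eq_comm _ r]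
  rw [← sum_filter, sum_const, uniformProb, nsmul_eq_mul, ENNReal.toReal_mul, ENNReal.toReal_inv,
    ENNReal.toReal_natCast, ENNReal.toReal_natCast, div_eq_mul_inv]

end RandQueryAlg

theorem relDist_eq_uniformProb {D A : Type} [Fintype D] [DecidableEq A] (f g : D → A) :
    relDist f g = uniformProb fun x => f x ≠ g x := by
  unfold relDist uniformProb hammingDist
  congr!

/-! ### Functions whose sum along every line vanishes -/

theorem card_erase_zero_cast (K : Type) [Zero K] [Fintype K] [DecidableEq K] :
    ((#(univ.erase (0 : K)) : ℕ) : ℝ) = (Fintype.card K : ℝ) - 1 := by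
  rw [card_erase_of_mem (mem_univ _), Nat.cast_sub (card_pos.2 ⟨0, mem_univ _⟩)]
  simp

/-- A uniformly distributed point and a uniformly distributed direction give a uniformly distributed
line. -/
theorem uniformProb_lineThrough {K V R : Type} [Zero K] [DecidableEq K] [Fintype K]
    [AddCommGroup V] [Fintype V] [Fintype R] [AddCommGroup R] (p : V × V × (K → R) → Prop) :
    uniformProb (fun ω : (V × R) × (V × (K → R)) =>
      p (ω.1.1, ω.2.1, fun a => if a = 0 then ω.1.2 else ω.2.2 a)) = uniformProb p := by
  refine uniformProb_comp_affine (fun ω : (V × R) × (V × (K → R)) =>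
    ((ω.1.1, ω.2.1, fun a => if a = 0 then ω.1.2 else ω.2.2 a) : V × V × (K → R)))
    (fun ω ω' => ?_) ?_ p
  · refine Prod.ext ?_ (Prod.ext ?_ (funext fun b => ?_))
    · simp
    · simp
    · by_cases hb : b = 0 <;> simp [hb]
  · rintro ⟨y, v, s⟩
    refine ⟨((y, s 0), (v, s)), Prod.ext rfl (Prod.ext rfl (funext fun b => ?_))⟩
    by_cases hb : b = 0 <;> simp [hb]

section Lines

variable {K V R : Type} [Field K] [Fintype K] [AddCommGroup V] [Module K V]

/-- Direction zero is harmless because `k` is even: the constant sum `k * f y` vanishes. Directions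
can thus be drawn uniformly from the whole group `V`. -/
theorem mem_liftCode_parityCheckCode_iff (hK : (Fintype.card K : ZMod 2) = 0) {f : V → ZMod 2} :
    f ∈ liftCode K V (parityCheckCode (ZMod 2) K) ↔ ∀ y v : V, ∑ a : K, f (y + a • v) = 0 := by
  constructor
  · intro hf y v
    rcases eq_or_ne v 0 with rfl | hv
    · simp [hK]
    · have hy : y ≠ y + v := by simpa using hv
      have := hf (AffineMap.lineMap y (y + v)) (AffineMap.lineMap_injective K hy)
      change ∑ a : K, f (AffineMap.lineMap y (y + v) a) = 0 at this
      simpa [AffineMap.lineMap_apply, add_comm] using this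
  · intro hf φ _
    change ∑ a : K, f (φ a) = 0
    rw [← hf (φ 0) (φ.linear 1)]
    refine sum_congr rfl fun a _ => ?_
    have := φ.map_vadd 0 a
    rw [← map_smul, smul_eq_mul, mul_one]
    simpa [add_comm] using congrArg f this

variable [DecidableEq K]

/-- The correction of `f` at `x` along the direction `ω.1`; the second coordinates of the queries
are given by `ω.2`. -/
def lineCorrection (f : V × R → ZMod 2) (x : V) (ω : V × (K → R)) : ZMod 2 :=
  ∑ a ∈ univ.erase (0 : K), f (x + a • ω.1, ω.2 a)

/-- The sum of `f` along the line through `ω.1` with direction `ω.2.1`; the second coordinates of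
the queries are given by `ω.2.2`. -/
def lineSum (f : V × R → ZMod 2) (ω : V × V × (K → R)) : ZMod 2 :=
  ∑ a : K, f (ω.1 + a • ω.2.1, ω.2.2 a)

theorem lineSum_eq_zero_iff (f : V × R → ZMod 2) (y v : V) (s : K → R) :
    lineSum f (y, v, s) = 0 ↔ f (y, s 0) = lineCorrection f y (v, s) := by
  rw [lineSum, lineCorrection, ← add_sum_erase univ _ (mem_univ (0 : K)), CharTwo.add_eq_zero]
  simp

theorem lineCorrection_eq (hK : (Fintype.card K : ZMod 2) = 0) {g : V → ZMod 2}
    (hg : g ∈ liftCode K V (parityCheckCode (ZMod 2) K)) (x u : V) :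
    ∑ a ∈ univ.erase (0 : K), g (x + a • u) = g x := by
  have := (mem_liftCode_parityCheckCode_iff hK).1 hg x u
  rw [← add_sum_erase univ _ (mem_univ (0 : K)), CharTwo.add_eq_zero] at this
  simpa using this.symm

variable [Fintype V] [Fintype R] [AddCommGroup R]

/-- Each query of the corrector is uniformly distributed. -/
theorem uniformProb_lineCorrection_ne_le (hK : (Fintype.card K : ZMod 2) = 0) (f : V × R → ZMod 2)
    {g : V → ZMod 2} (hg : g ∈ liftCode K V (parityCheckCode (ZMod 2) K)) (x : V) :
    uniformProb (fun ω : V × (K → R) => lineCorrection f x ω ≠ g x) ≤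
      ((Fintype.card K : ℝ) - 1) * uniformProb fun z => f z ≠ g z.1 := by
  rw [← card_erase_zero_cast K, ← nsmul_eq_mul, ← sum_const]
  -- Union bound: a wrong output needs a wrong answer at some `a ≠ 0`, and dividing by `a` shows
  -- that this query is uniform on `V × R`.
  refine (uniformProb_le_sum (univ.erase (0 : K))
    (q := fun a ω => f (x + a • ω.1, ω.2 a) ≠ g (x + a • ω.1)) fun ω hω => ?_).trans
    (sum_le_sum fun a ha => ?_)
  · contrapose! hω
    rw [← lineCorrection_eq hK hg x ω.1]
    exact sum_congr rfl hω
  · have ha0 : a ≠ 0 := (mem_erase.1 ha).1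
    refine (uniformProb_comp_affine (fun ω : V × (K → R) => (x + a • ω.1, ω.2 a)) ?_ ?_
      (fun z => f z ≠ g z.1)).le
    · intro ω ω'
      ext <;> simp
      abel
    · rintro ⟨y, r⟩
      exact ⟨(a⁻¹ • (y - x), fun _ => r), by simp [ha0]⟩

/-- At a point where the codewords differ, the corrector for `g` run on `f` always returns the value
of `f`, so it errs with probability one. -/
theorem one_le_uniformProb_ne_of_ne (hK : (Fintype.card K : ZMod 2) = 0) {f g : V → ZMod 2}
    (hf : f ∈ liftCode K V (parityCheckCode (ZMod 2) K))
    (hg : g ∈ liftCode K V (parityCheckCode (ZMod 2) K)) (hfg : f ≠ g) :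
    1 ≤ ((Fintype.card K : ℝ) - 1) * uniformProb fun z : V × R => f z.1 ≠ g z.1 := by
  obtain ⟨x, hx⟩ := Function.ne_iff.1 hfg
  refine le_trans ?_ (uniformProb_lineCorrection_ne_le hK (fun z : V × R => f z.1) hg x)
  refine (uniformProb_true fun ω => ?_).ge
  simpa only [lineCorrection, lineCorrection_eq hK hf] using hx

/-- The rows of a random grid of points at `x` are uniformly distributed. -/
theorem uniformProb_gridRow (x : V) {a : K} (ha : a ≠ 0) (p : V × V × (K → R) → Prop) :
    uniformProb (fun ω : ((V × (K → R)) × (V × (K → R))) × (K → K → R) =>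
      p (x + a • ω.1.1.1, ω.1.2.1, fun b => if b = 0 then ω.1.1.2 a else ω.2 a b)) =
      uniformProb p := by
  refine uniformProb_comp_affine (fun ω : ((V × (K → R)) × (V × (K → R))) × (K → K → R) =>
    ((x + a • ω.1.1.1, ω.1.2.1, fun b => if b = 0 then ω.1.1.2 a else ω.2 a b) :
      V × V × (K → R))) (fun ω ω' => ?_) ?_ p
  · refine Prod.ext ?_ (Prod.ext ?_ (funext fun b => ?_))
    · simp only [Prod.fst_add, Prod.fst_zero, smul_add, smul_zero]; abel
    · simp
    · by_cases hb : b = 0 <;> simp [hb]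
  · rintro ⟨y, v, s⟩
    refine ⟨(((a⁻¹ • (y - x), fun _ => s 0), (v, 0)), fun _ => s), ?_⟩
    refine Prod.ext ?_ (Prod.ext rfl (funext fun b => ?_))
    · simp [ha]
    · by_cases hb : b = 0 <;> simp [hb]

/-- The columns of a random grid of points at `x` are uniformly distributed. -/
theorem uniformProb_gridColumn (x : V) {b : K} (hb : b ≠ 0) (p : V × V × (K → R) → Prop) :
    uniformProb (fun ω : ((V × (K → R)) × (V × (K → R))) × (K → K → R) =>
      p (x + b • ω.1.2.1, ω.1.1.1, fun a => if a = 0 then ω.1.2.2 b else ω.2 a b)) =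
      uniformProb p := by
  -- Exchanging the two directions and transposing the array turns columns into rows.
  rw [← uniformProb_gridRow x hb p, ← uniformProb_comp_equiv
    ((Equiv.prodComm (V × (K → R)) (V × (K → R))).prodCongr (Equiv.piComm fun _ _ : K => R))]
  rfl

/-- The correctors in a random grid over a line are uniformly distributed. -/
theorem uniformProb_skewRow (b : K) (p : V × (K → R) → Prop) :
    uniformProb (fun ω : V × V × (K → K → R) => p (ω.1 + b • ω.2.1, fun a => ω.2.2 a b)) =
      uniformProb p := by
  refine uniformProb_comp_affine (fun ω : V × V × (K → K → R) =>
    ((ω.1 + b • ω.2.1, fun a => ω.2.2 a b) : V × (K → R))) (fun ω ω' => ?_) ?_ p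
  · refine Prod.ext ?_ (funext fun a => ?_)
    · simp only [Prod.fst_add, Prod.fst_zero, Prod.snd_add, Prod.snd_zero, smul_add, smul_zero]
      abel
    · simp
  · rintro ⟨u, s⟩
    exact ⟨(u, 0, fun a _ => s a), by simp⟩

/-- The columns of a random grid over a line are uniformly distributed. -/
theorem uniformProb_skewColumn (y w : V) {a : K} (ha : a ≠ 0) (p : V × V × (K → R) → Prop) :
    uniformProb (fun ω : V × V × (K → K → R) => p (y + a • ω.1, w + a • ω.2.1, ω.2.2 a)) =
      uniformProb p := by
  refine uniformProb_comp_affine (fun ω : V × V × (K → K → R) =>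
    ((y + a • ω.1, w + a • ω.2.1, ω.2.2 a) : V × V × (K → R))) (fun ω ω' => ?_) ?_ p
  · refine Prod.ext ?_ (Prod.ext ?_ (funext fun b => ?_))
    · simp only [Prod.fst_add, Prod.fst_zero, smul_add, smul_zero]; abel
    · simp only [Prod.fst_add, Prod.fst_zero, Prod.snd_add, Prod.snd_zero, smul_add, smul_zero]
      abel
    · simp
  · rintro ⟨z, v, s⟩
    exact ⟨(a⁻¹ • (z - y), a⁻¹ • (v - w), fun _ => s), by simp [ha]⟩

/-- The corrections along two independent directions agree unless one of the lines of the grid that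
they span is rejected. -/
theorem uniformProb_lineCorrection_ne_lineCorrection_le (f : V × R → ZMod 2) (x : V) :
    uniformProb (fun ω : (V × (K → R)) × (V × (K → R)) =>
        lineCorrection f x ω.1 ≠ lineCorrection f x ω.2) ≤
      2 * ((Fintype.card K : ℝ) - 1) *
        uniformProb fun ω : V × V × (K → R) => lineSum f ω ≠ 0 := by
  -- The entry on the axis reuses the second coordinate drawn by the corrector, so that the row test
  -- compares exactly that query with the interior of the grid. The array `ω.2`, added to the seed,
  -- serves the interior and is shared by rows and columns.
  let row (a : K) (ω : ((V × (K → R)) × (V × (K → R))) × (K → K → R)) : V × V × (K → R) :=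
    (x + a • ω.1.1.1, ω.1.2.1, fun b => if b = 0 then ω.1.1.2 a else ω.2 a b)
  let col (b : K) (ω : ((V × (K → R)) × (V × (K → R))) × (K → K → R)) : V × V × (K → R) :=
    (x + b • ω.1.2.1, ω.1.1.1, fun a => if a = 0 then ω.1.2.2 b else ω.2 a b)
  rw [← uniformProb_comp_fst (Ω' := K → K → R), mul_assoc, two_mul, ← card_erase_zero_cast K,
    ← nsmul_eq_mul, ← sum_const]
  have hrow : ∀ a ∈ univ.erase (0 : K), uniformProb (fun ω :
      ((V × (K → R)) × (V × (K → R))) × (K → K → R) => lineSum f (row a ω) ≠ 0) =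
      uniformProb fun ω : V × V × (K → R) => lineSum f ω ≠ 0 := fun a ha => by
    exact uniformProb_gridRow x (mem_erase.1 ha).1 fun ω => lineSum f ω ≠ 0
  have hcol : ∀ a ∈ univ.erase (0 : K), uniformProb (fun ω :
      ((V × (K → R)) × (V × (K → R))) × (K → K → R) => lineSum f (col a ω) ≠ 0) =
      uniformProb fun ω : V × V × (K → R) => lineSum f ω ≠ 0 := fun a ha => by
    exact uniformProb_gridColumn x (mem_erase.1 ha).1 fun ω => lineSum f ω ≠ 0
  refine le_trans (uniformProb_mono (q := fun ω : ((V × (K → R)) × (V × (K → R))) × (K → K → R) =>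
    (∃ a ∈ univ.erase (0 : K), lineSum f (row a ω) ≠ 0) ∨
      ∃ b ∈ univ.erase (0 : K), lineSum f (col b ω) ≠ 0) ?_) ((uniformProb_or_le _ _).trans
    (add_le_add ((uniformProb_le_sum _ fun _ h => h).trans (sum_le_sum fun a ha => (hrow a ha).le))
      ((uniformProb_le_sum _ fun _ h => h).trans (sum_le_sum fun a ha => (hcol a ha).le))))
  intro ω hω
  contrapose! hω
  obtain ⟨h1, h2⟩ := hω
  have e1 : ∀ a ∈ univ.erase (0 : K), f (x + a • ω.1.1.1, ω.1.1.2 a) =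
      ∑ b ∈ univ.erase (0 : K), f (x + a • ω.1.1.1 + b • ω.1.2.1, ω.2 a b) := fun a ha => by
    have := (lineSum_eq_zero_iff f _ _ _).1 (h1 a ha)
    rw [lineCorrection] at this
    simp only [if_true] at this
    rw [this]
    exact sum_congr rfl fun b hb => by simp [(mem_erase.1 hb).1]
  have e2 : ∀ b ∈ univ.erase (0 : K), f (x + b • ω.1.2.1, ω.1.2.2 b) =
      ∑ a ∈ univ.erase (0 : K), f (x + a • ω.1.1.1 + b • ω.1.2.1, ω.2 a b) := fun b hb => by
    have := (lineSum_eq_zero_iff f _ _ _).1 (h2 b hb)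
    rw [lineCorrection] at this
    simp only [if_true] at this
    rw [this]
    exact sum_congr rfl fun a ha => by simp [(mem_erase.1 ha).1, add_right_comm]
  rw [lineCorrection, lineCorrection, sum_congr rfl e1, sum_congr rfl e2, sum_comm]

/-- A function rejected with small probability by the line test is close to the code. -/
theorem exists_mem_liftCode_near (hK : (Fintype.card K : ZMod 2) = 0) (f : V × R → ZMod 2)
    (hρ : (2 * (Fintype.card K : ℝ) + 1) * ((Fintype.card K : ℝ) - 1) *
      uniformProb (fun ω : V × V × (K → R) => lineSum f ω ≠ 0) < 1) :
    ∃ g ∈ liftCode K V (parityCheckCode (ZMod 2) K),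
      uniformProb (fun z : V × R => f z ≠ g z.1) ≤
        2 * uniformProb (fun ω : V × V × (K → R) => lineSum f ω ≠ 0) := by
  choose g hg_half hg using fun x : V =>
    exists_majority fun ω : V × (K → R) => lineCorrection f x ω
  have hg' := fun x => (hg x).trans (uniformProb_lineCorrection_ne_lineCorrection_le f x)
  set ρ := uniformProb fun ω : V × V × (K → R) => lineSum f ω ≠ 0
  refine ⟨g, (mem_liftCode_parityCheckCode_iff hK).2 fun y w => ?_, ?_⟩
  · let dir (b : K) (ω : V × V × (K → K → R)) : V × (K → R) := (ω.1 + b • ω.2.1, fun a => ω.2.2 a b)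
    let col (a : K) (ω : V × V × (K → K → R)) : V × V × (K → R) :=
      (y + a • ω.1, w + a • ω.2.1, ω.2.2 a)
    have hdir : ∀ b ∈ (univ : Finset K), uniformProb (fun ω : V × V × (K → K → R) =>
        lineCorrection f (y + b • w) (dir b ω) ≠ g (y + b • w)) ≤
          2 * ((Fintype.card K : ℝ) - 1) * ρ := fun b _ => by
      exact (uniformProb_skewRow b fun ω => lineCorrection f (y + b • w) ω ≠ g (y + b • w)).le.trans
        (hg' _)
    have hcol : ∀ a ∈ univ.erase (0 : K), uniformProb
        (fun ω : V × V × (K → K → R) => lineSum f (col a ω) ≠ 0) ≤ ρ := fun a ha =>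
      (uniformProb_skewColumn y w (mem_erase.1 ha).1 fun ω => lineSum f ω ≠ 0).le
    have hbad : uniformProb (fun ω : V × V × (K → K → R) => ¬ ((∀ b ∈ (univ : Finset K),
        lineCorrection f (y + b • w) (dir b ω) = g (y + b • w)) ∧
          ∀ a ∈ univ.erase (0 : K), lineSum f (col a ω) = 0)) < 1 := by
      refine lt_of_le_of_lt (uniformProb_mono (q := fun ω : V × V × (K → K → R) =>
        (∃ b ∈ (univ : Finset K), lineCorrection f (y + b • w) (dir b ω) ≠ g (y + b • w)) ∨
          ∃ a ∈ univ.erase (0 : K), lineSum f (col a ω) ≠ 0) fun ω hω => ?_) ?_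
      · contrapose! hω
        exact hω
      · refine lt_of_le_of_lt ((uniformProb_or_le _ _).trans (add_le_add
          ((uniformProb_le_sum _ fun _ h => h).trans (sum_le_sum hdir))
          ((uniformProb_le_sum _ fun _ h => h).trans (sum_le_sum hcol)))) ?_
        rw [sum_const, sum_const, nsmul_eq_mul, nsmul_eq_mul,
          card_erase_zero_cast K, card_univ]
        -- The `k` corrections and `k - 1` columns fail with total probability at most `k * (2 * (k
        -- - 1) * ρ) + (k - 1) * ρ`, the quantity bounded in `hρ`.
        linarith
    obtain ⟨ω, h1, h2⟩ := exists_of_uniformProb_not_lt_one hbad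
    rw [← sum_congr rfl h1]
    simp only [lineCorrection]
    rw [sum_comm]
    refine sum_eq_zero fun a ha => ?_
    rw [← h2 a ha, lineSum]
    refine sum_congr rfl fun b _ => ?_
    simp only [dir, col, smul_add, smul_comm a b]
    congr 2
    abel
  -- Draw the point `z` of the line first. If `f z` is not the majority value, at least half of the
  -- directions give a correction different from `f z`, and each of these is a rejection.
  · let ψ (ω : (V × R) × (V × (K → R))) : V × V × (K → R) :=
      (ω.1.1, ω.2.1, fun a => if a = 0 then ω.1.2 else ω.2.2 a)
    have hψ : uniformProb (fun ω => lineSum f (ψ ω) ≠ 0) = ρ := by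
      exact uniformProb_lineThrough fun ω => lineSum f ω ≠ 0
    have hψ' : ∀ z ω, lineSum f (ψ (z, ω)) ≠ 0 ↔ lineCorrection f z.1 ω ≠ f z := fun z ω => by
      rw [ne_eq, lineSum_eq_zero_iff, ne_eq, eq_comm, if_pos rfl]
      refine not_congr (Eq.congr_left (sum_congr rfl fun a ha => ?_))
      simp [(mem_erase.1 ha).1]
    classical
    rw [← hψ, uniformProb_prod fun ω => lineSum f (ψ ω) ≠ 0,
      uniformProb_eq_sum fun z : V × R => f z ≠ g z.1, mul_div_assoc', mul_sum]
    gcongr with z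
    split_ifs with hz
    · simp only [hψ']
      have hnot := uniformProb_not fun ω : V × (K → R) => lineCorrection f z.1 ω ≠ g z.1
      have := hg_half z.1
      have hle : uniformProb (fun ω : V × (K → R) => ¬ lineCorrection f z.1 ω ≠ g z.1) ≤
          uniformProb fun ω : V × (K → R) => lineCorrection f z.1 ω ≠ f z :=
        uniformProb_mono fun ω hω => by rw [not_not.1 hω]; exact Ne.symm hz
      linarith
    · exact mul_nonneg zero_le_two (uniformProb_nonneg _)

end Lines

/-! ### The dimension of the lifted code -/

section Dimension

/-- On a line the product is a polynomial in `a` of degree below `k - 1`, and power sums over `K`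
vanish for such exponents. -/
theorem sum_prod_affine_eq_zero {K ι : Type} [Field K] [Fintype K] (S : Finset ι)
    (hS : #S < Fintype.card K - 1) (y v : ι → K) : ∑ a : K, ∏ i ∈ S, (y i + a * v i) = 0 := by
  classical
  simp only [prod_add, prod_mul_distrib, prod_const]
  rw [sum_comm]
  refine sum_eq_zero fun T _ => ?_
  rw [← mul_sum, ← sum_mul,
    FiniteField.sum_pow_lt_card_sub_one K _ ((card_le_card sdiff_subset).trans_lt hS)]
  simp

/-- At the indicator of `T` only monomials supported inside `T` survive; as all supports have size
`d`, this isolates the coefficient of `T`. -/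
theorem eq_zero_of_sum_prod_coord_eq_zero (K ι : Type) [Field K] [DecidableEq ι] [Fintype ι] (d : ℕ)
    (c : powersetCard d (univ : Finset ι) → K)
    (hc : ∀ x : ι → K, ∑ S, c S * ∏ i ∈ S.1, x i = 0) : c = 0 := by
  funext T
  rw [Pi.zero_apply, ← hc fun i => if i ∈ T.1 then 1 else 0, sum_eq_single T]
  · rw [prod_congr rfl fun i hi => if_pos hi]
    simp
  · intro S _ hST
    rw [prod_ite_zero, if_neg, mul_zero]
    intro h
    refine hST (Subtype.ext (eq_of_subset_of_card_le h ?_))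
    rw [(mem_powersetCard.1 S.2).2, (mem_powersetCard.1 T.2).2]
  · simp

variable {K : Type} [Field K] [Fintype K]

/-- A polynomial is recorded by its `r = [K : F_2]` coordinate functions, all of which are
codewords. The factor `r` appears on both sides of the dimension inequality and cancels. -/
theorem choose_le_finrank_liftCode [CharP K 2] (hK : (Fintype.card K : ZMod 2) = 0) (n d : ℕ)
    (hd : d < Fintype.card K - 1) :
    n.choose d ≤ Module.finrank (ZMod 2) (liftCode K (Fin n → K) (parityCheckCode (ZMod 2) K)) := by
  classical
  let := ZMod.algebra K 2
  let b := Module.finBasis (ZMod 2) K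
  let r := Module.finrank (ZMod 2) K
  let Λ := liftCode K (Fin n → K) (parityCheckCode (ZMod 2) K)
  let P (c : powersetCard d (univ : Finset (Fin n)) → K) (x : Fin n → K) : K :=
    ∑ S, c S * ∏ i ∈ S.1, x i
  let Φ : (powersetCard d (univ : Finset (Fin n)) → K) →ₗ[ZMod 2] (Fin r → Λ) :=
    LinearMap.pi fun j => LinearMap.codRestrict Λ
      { toFun := fun c x => b.coord j (P c x)
        map_add' := fun c c' => by
          funext x
          simp only [P, Pi.add_apply, add_mul, sum_add_distrib, map_add]
        map_smul' := fun z c => by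
          funext x
          simp only [P, Pi.smul_apply, smul_mul_assoc, ← smul_sum, map_smul, RingHom.id_apply] }
      fun c => (mem_liftCode_parityCheckCode_iff hK).2 fun y v => by
        change ∑ a : K, b.coord j (P c (y + a • v)) = 0
        rw [← map_sum]
        simp only [P]
        rw [sum_comm, sum_eq_zero, map_zero]
        intro S _
        rw [← mul_sum]
        simp only [Pi.add_apply, Pi.smul_apply, smul_eq_mul]
        rw [sum_prod_affine_eq_zero _ (by rwa [(mem_powersetCard.1 S.2).2]), mul_zero]
  have hΦ : Function.Injective Φ := by
    rw [← LinearMap.ker_eq_bot, LinearMap.ker_eq_bot']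
    intro c hc
    refine eq_zero_of_sum_prod_coord_eq_zero K (Fin n) d c fun x => ?_
    refine b.ext_elem fun j => ?_
    have : b.coord j (P c x) = 0 := congrArg (fun g => (g j : (Fin n → K) → ZMod 2) x) hc
    rw [map_zero, Finsupp.zero_apply]
    exact this
  have h := LinearMap.finrank_le_finrank_of_injective hΦ
  rw [Module.finrank_pi_fintype, Module.finrank_pi_fintype, sum_const, sum_const, card_univ,
    card_univ, Fintype.card_coe, card_powersetCard, card_univ, Fintype.card_fin, Fintype.card_fin,
    smul_eq_mul, smul_eq_mul, mul_comm] at h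
  exact le_of_mul_le_mul_left h Module.finrank_pos

theorem one_le_finrank_liftCode (hK : (Fintype.card K : ZMod 2) = 0) (V : Type) [AddCommGroup V]
    [Module K V] [Finite V] :
    1 ≤ Module.finrank (ZMod 2) (liftCode K V (parityCheckCode (ZMod 2) K)) := by
  have h1 : (fun _ => 1) ∈ liftCode K V (parityCheckCode (ZMod 2) K) :=
    (mem_liftCode_parityCheckCode_iff hK).2 fun y v => by simp [hK]
  have : Nontrivial (liftCode K V (parityCheckCode (ZMod 2) K)) :=
    ⟨⟨⟨_, h1⟩, 0, fun h => one_ne_zero (congrFun (congrArg Subtype.val h) 0)⟩⟩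
  exact Module.finrank_pos

/-- A constant for which the dimension of the lifted code is at least polynomial. -/
noncomputable def dimConst (t d : ℕ) : ℝ := ((2 * t * (d + 1) : ℝ) ^ d * d.factorial)⁻¹

theorem dimConst_pos {t : ℕ} (ht : 0 < t) (d : ℕ) : 0 < dimConst t d := by
  unfold dimConst
  positivity

theorem dimConst_mul_pow_le {t : ℕ} (ht : 0 < t) (d n m D : ℕ) (hm : m ≤ t * (n + 1))
    (h1 : 1 ≤ D) (hD : n.choose d ≤ D) : dimConst t d * (m : ℝ) ^ d ≤ D := by
  have hD' : (n.choose d : ℝ) ≤ D := by exact_mod_cast hD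
  have h1' : (1 : ℝ) ≤ D := by exact_mod_cast h1
  have hm' : (m : ℝ) ≤ t * (n + 1) := by exact_mod_cast hm
  have ht' : (1 : ℝ) ≤ t := by exact_mod_cast ht
  have hfac : (1 : ℝ) ≤ d.factorial := by exact_mod_cast d.factorial_pos
  unfold dimConst
  rw [inv_mul_le_iff₀ (by positivity)]
  rcases le_or_gt (n + 1) (2 * (d + 1)) with h | h
  -- For small `n` the binomial may vanish; `m` is then bounded and dimension one suffices.
  · have h' : (n + 1 : ℝ) ≤ 2 * (d + 1) := by exact_mod_cast h
    calc (m : ℝ) ^ d ≤ (2 * t * (d + 1)) ^ d := by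
          gcongr
          nlinarith
      _ ≤ (2 * t * (d + 1)) ^ d * d.factorial * D := by
          rw [mul_assoc _ (d.factorial : ℝ)]
          exact le_mul_of_one_le_right (by positivity) (one_le_mul_of_one_le_of_one_le hfac h1')
  -- For large `n`, `n + 1 - d` is comparable to `n + 1`, and the binomial is at least `(n + 1 - d)
  -- ^ d / d!`.
  · have hle : d ≤ n + 1 := by omega
    have h' : (2 * (d + 1) : ℝ) ≤ n + 1 := by exact_mod_cast h.le
    have hch := Nat.pow_le_choose (α := ℝ) d n
    rw [div_le_iff₀ (by positivity), Nat.cast_sub hle] at hch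
    push_cast at hch
    calc (m : ℝ) ^ d ≤ (2 * t * (d + 1) * (n + 1 - d)) ^ d := by
          gcongr
          have : (n + 1 : ℝ) ≤ 2 * (d + 1) * (n + 1 - d) := by nlinarith
          nlinarith
      _ = (2 * t * (d + 1)) ^ d * (n + 1 - d) ^ d := mul_pow _ _ _
      _ ≤ (2 * t * (d + 1)) ^ d * (n.choose d * d.factorial) := by gcongr
      _ ≤ (2 * t * (d + 1)) ^ d * d.factorial * D := by
          rw [mul_assoc _ (d.factorial : ℝ), mul_comm (n.choose d : ℝ)]
          gcongr

end Dimension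

/-! ### The lifted code with repeated coordinates -/

section Repetition

theorem relDist_comp_fst {V R D : Type} [Fintype V] [Fintype R] [Fintype D] (e : D ≃ V × R)
    (f : D → ZMod 2) (g : V → ZMod 2) :
    relDist f (fun x => g (e x).1) = uniformProb fun z : V × R => f (e.symm z) ≠ g z.1 := by
  rw [relDist_eq_uniformProb, ← uniformProb_comp_equiv e]
  simp

variable {K V R D : Type} [Field K] [Fintype K] [AddCommGroup V] [Module K V]

/-- The lift to `V` of the parity-check code on `K`, with each coordinate repeated once for each
element of `R`. -/
def repeatedLift (K : Type) [Field K] [Fintype K] [Module K V] (e : D ≃ V × R) :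
    Submodule (ZMod 2) (D → ZMod 2) :=
  (liftCode K V (parityCheckCode (ZMod 2) K)).map
    (LinearMap.funLeft (ZMod 2) (ZMod 2) fun x => (e x).1)

theorem mem_repeatedLift {e : D ≃ V × R} {f : D → ZMod 2} :
    f ∈ repeatedLift K e ↔
      ∃ g ∈ liftCode K V (parityCheckCode (ZMod 2) K), (fun x => g (e x).1) = f :=
  Iff.rfl

theorem finrank_repeatedLift [Nonempty R] (e : D ≃ V × R) :
    Module.finrank (ZMod 2) (repeatedLift K e) =
      Module.finrank (ZMod 2) (liftCode K V (parityCheckCode (ZMod 2) K)) := by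
  refine (LinearEquiv.finrank_eq (Submodule.equivMapOfInjective _ ?_ _)).symm
  exact LinearMap.funLeft_injective_of_surjective _ _ _
    (Prod.fst_surjective.comp e.surjective)

variable [Fintype V] [Fintype R] [AddCommGroup R] [Fintype D]

theorem isLCC_repeatedLift (hK : (Fintype.card K : ZMod 2) = 0) (e : D ≃ V × R) :
    IsLCC (repeatedLift K e : Set (D → ZMod 2)) (Fintype.card K - 1)
      ((Fintype.card K : ℝ)⁻¹ / 3) := by
  classical
  refine ⟨fun x => RandQueryAlg.querySum (Ω := V × (K → R)) (univ.erase (0 : K))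
    (fun ω a => e.symm ((e x).1 + a • ω.1, ω.2 a)) id, fun x => ?_, fun x f g hg hfg => ?_⟩
  · simpa using RandQueryAlg.makesAtMost_querySum (Ω := V × (K → R)) (univ.erase (0 : K))
      (fun ω a => e.symm ((e x).1 + a • ω.1, ω.2 a)) (id : ZMod 2 → ZMod 2)
  · obtain ⟨g, hg, rfl⟩ := hg
    change relDist f (fun x => g (e x).1) ≤ _ at hfg
    change _ ≤ RandQueryAlg.outputProb _ f (g (e x).1)
    rw [relDist_comp_fst] at hfg
    have h := uniformProb_lineCorrection_ne_le hK (fun z => f (e.symm z)) hg (e x).1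
    rw [uniformProb_not] at h
    rw [RandQueryAlg.outputProb_querySum]
    change _ ≤ uniformProb fun ω => lineCorrection (fun z => f (e.symm z)) (e x).1 ω = g (e x).1
    have hk : (1 : ℝ) ≤ Fintype.card K := by exact_mod_cast Fintype.card_pos
    have : ((Fintype.card K : ℝ) - 1) * uniformProb (fun z => f (e.symm z) ≠ g z.1) ≤ 1 / 3 :=
      calc _ ≤ ((Fintype.card K : ℝ) - 1) * ((Fintype.card K : ℝ)⁻¹ / 3) := by gcongr
        _ = 1 / 3 - (Fintype.card K : ℝ)⁻¹ / 3 := by field_simp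
        _ ≤ 1 / 3 := sub_le_self _ (by positivity)
    linarith

theorem hasDistance_repeatedLift (hK : (Fintype.card K : ZMod 2) = 0) (e : D ≃ V × R) :
    HasDistance (repeatedLift K e : Set (D → ZMod 2)) (Fintype.card K : ℝ)⁻¹ := by
  classical
  rintro _ ⟨f, hf, rfl⟩ _ ⟨g, hg, rfl⟩ hfg
  change _ < relDist (fun x => f (e x).1) (fun x => g (e x).1)
  have hfg' : f ≠ g := fun h => hfg (by rw [h])
  have h := one_le_uniformProb_ne_of_ne (R := R) hK hf hg hfg'
  rw [relDist_comp_fst]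
  simp only [Equiv.apply_symm_apply]
  have h0 := uniformProb_nonneg fun z : V × R => f z.1 ≠ g z.1
  have hk : (0 : ℝ) < Fintype.card K := by exact_mod_cast Fintype.card_pos
  rw [inv_lt_iff_one_lt_mul₀ hk]
  rcases h0.eq_or_lt with h0 | h0
  · rw [← h0] at h; linarith
  · linarith

theorem isLTC_repeatedLift (hK : (Fintype.card K : ZMod 2) = 0) (e : D ≃ V × R) :
    IsLTC (repeatedLift K e : Set (D → ZMod 2)) (Fintype.card K)
      (1 / 2 * ((Fintype.card K : ℝ) ^ 2)⁻¹) (Fintype.card K : ℝ)⁻¹ := by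
  classical
  have hout : ∀ f c, (RandQueryAlg.querySum (Ω := V × V × (K → R)) (univ : Finset K)
      (fun ω a => e.symm (ω.1 + a • ω.2.1, ω.2.2 a))
      (fun b : ZMod 2 => decide (b = 0))).outputProb f c =
        uniformProb fun ω => decide (lineSum (fun z => f (e.symm z)) ω = 0) = c := fun f c => by
    rw [RandQueryAlg.outputProb_querySum]
    rfl
  refine ⟨hasDistance_repeatedLift hK e, RandQueryAlg.querySum (Ω := V × V × (K → R))
    (univ : Finset K) (fun ω a => e.symm (ω.1 + a • ω.2.1, ω.2.2 a))
    (fun b : ZMod 2 => decide (b = 0)), ?_, fun f hf => ?_, fun τ f hf => ?_⟩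
  · simpa using RandQueryAlg.makesAtMost_querySum (Ω := V × V × (K → R)) (univ : Finset K)
      (fun ω a => e.symm (ω.1 + a • ω.2.1, ω.2.2 a)) (fun b : ZMod 2 => decide (b = 0))
  · obtain ⟨g, hg, rfl⟩ := hf
    rw [hout]
    refine uniformProb_true fun ω => decide_eq_true ?_
    have := (mem_liftCode_parityCheckCode_iff hK).1 hg ω.1 ω.2.1
    simpa [lineSum, LinearMap.funLeft_apply] using this
  · rw [hout]
    simp only [decide_eq_false_iff_not]
    set ρ := uniformProb fun ω : V × V × (K → R) => ¬ lineSum (fun z => f (e.symm z)) ω = 0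
    have hρ0 : 0 ≤ ρ := uniformProb_nonneg _
    have hk : (1 : ℝ) ≤ Fintype.card K := by exact_mod_cast Fintype.card_pos
    have hk2 : (0 : ℝ) < (Fintype.card K : ℝ) ^ 2 := by positivity
    -- The zero codeword is at distance at most one from `f`.
    have hτ : τ < 1 := by
      refine (hf 0 (zero_mem _)).trans_le ?_
      rw [relDist_eq_uniformProb]
      exact uniformProb_le_one _
    rw [mul_right_comm, mul_inv_le_iff₀ hk2]
    -- If this fails, `ρ` is at least `1 / (2 * k ^ 2)`, since `(2 * k + 1) * (k - 1) ≤ 2 * k ^ 2`;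
    -- with `τ < 1` this is enough. Otherwise `τ < 2 * ρ`, which is more than needed.
    by_cases hlt : (2 * (Fintype.card K : ℝ) + 1) * ((Fintype.card K : ℝ) - 1) * ρ < 1
    · obtain ⟨g, hg, hfg⟩ := exists_mem_liftCode_near hK (fun z => f (e.symm z)) hlt
      have := hf _ (mem_repeatedLift.2 ⟨g, hg, rfl⟩)
      rw [relDist_comp_fst] at this
      change _ ≤ 2 * ρ at hfg
      have := le_mul_of_one_le_right hρ0 (one_le_pow₀ hk (n := 2))
      linarith
    · nlinarith

end Repetition

/-! ### Lengths and parameters of the two families of codes -/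

theorem repeatedLift_prodUnique {K V : Type} [Field K] [Fintype K] [AddCommGroup V] [Module K V] :
    repeatedLift K (Equiv.prodUnique V Unit).symm = liftCode K V (parityCheckCode (ZMod 2) K) :=
  Submodule.map_id _

theorem card_cast_zmod_two {K : Type} [Fintype K] {t : ℕ} (ht : 0 < t)
    (hK : Fintype.card K = 2 ^ t) : (Fintype.card K : ZMod 2) = 0 := by
  rw [hK, Nat.cast_pow]
  exact (congrArg (· ^ t) (CharP.cast_eq_zero (ZMod 2) 2)).trans (zero_pow ht.ne')

theorem le_finrank_repeatedLift {K R D : Type} [Field K] [Fintype K] [Nonempty R] {t : ℕ}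
    (ht : 0 < t) (hK : Fintype.card K = 2 ^ t) {n m : ℕ} (hm : m ≤ t * (n + 1))
    (e : D ≃ (Fin n → K) × R) :
    dimConst t (2 ^ t - 2) * (m : ℝ) ^ (2 ^ t - 2) ≤
      Module.finrank (ZMod 2) (repeatedLift K e) := by
  have hchar : CharP K 2 := charP_of_card_eq_prime_pow hK
  have hK0 : (Fintype.card K : ZMod 2) = 0 := card_cast_zmod_two ht hK
  have h2 : 2 ≤ 2 ^ t := Nat.le_self_pow ht.ne' 2
  rw [finrank_repeatedLift]
  exact dimConst_mul_pow_le ht _ n m _ hm (one_le_finrank_liftCode hK0 _)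
    (choose_le_finrank_liftCode hK0 n _ (by omega))

theorem theorem1 :
    ∃ c₀ : ℝ, 0 < c₀ ∧
      ∀ t k : ℕ, 0 < t → k = 2 ^ t →
        ∃ c : ℝ, 0 < c ∧
          (∀ m N : ℕ, 0 < m → N = 2 ^ m →
            ∃ C : Submodule (ZMod 2) (Fin N → ZMod 2),
              c * (Real.logb 2 (N : ℝ)) ^ (k - 2) ≤ (Module.finrank (ZMod 2) C : ℝ) ∧
              IsLCC (C : Set (Fin N → ZMod 2)) (k - 1) ((k : ℝ)⁻¹ / 3) ∧
              IsLTC (C : Set (Fin N → ZMod 2)) k (c₀ * ((k : ℝ) ^ 2)⁻¹) ((k : ℝ)⁻¹)) ∧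
          (∀ (K : Type) [Field K] [Fintype K], Fintype.card K = k →
            ∀ n N : ℕ, 0 < n → N = k ^ n →
              ∀ L : Submodule (ZMod 2) ((Fin n → K) → ZMod 2),
                L = liftCode K (Fin n → K) (parityCheckCode (ZMod 2) K) →
                c * (Real.logb 2 (N : ℝ)) ^ (k - 2) ≤ (Module.finrank (ZMod 2) L : ℝ) ∧
                IsLCC (L : Set ((Fin n → K) → ZMod 2)) (k - 1) ((k : ℝ)⁻¹ / 3) ∧
                IsLTC (L : Set ((Fin n → K) → ZMod 2)) k (c₀ * ((k : ℝ) ^ 2)⁻¹)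
                  ((k : ℝ)⁻¹)) := by
  refine ⟨1 / 2, by norm_num, fun t k ht hk => ⟨dimConst t (k - 2), dimConst_pos ht _, ?_, ?_⟩⟩
  · rintro m N - rfl
    have := Fintype.ofFinite (GaloisField 2 t)
    have hcard : Fintype.card (GaloisField 2 t) = k := by
      rw [hk, ← GaloisField.card 2 t ht.ne', Nat.card_eq_fintype_card]
    have hK0 : (Fintype.card (GaloisField 2 t) : ZMod 2) = 0 :=
      card_cast_zmod_two ht (hcard.trans hk)
    -- Division of `m` by `t`: the quotient is the dimension over `K`, and the remainder is absorbed
    -- by repetition.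
    let e : Fin (2 ^ m) ≃ (Fin (m / t) → GaloisField 2 t) × (Fin (m % t) → ZMod 2) :=
      Fintype.equivOfCardEq (by
        simp only [Fintype.card_fin, Fintype.card_prod, Fintype.card_fun, ZMod.card, hcard, hk]
        rw [← pow_mul, ← pow_add, Nat.div_add_mod])
    refine ⟨repeatedLift (GaloisField 2 t) e, ?_, ?_, ?_⟩
    · rw [Nat.cast_pow, Nat.cast_ofNat, Real.logb_pow, Real.logb_self_eq_one one_lt_two, mul_one,
        hk]
      refine le_finrank_repeatedLift ht (hcard.trans hk) ?_ e
      exact (Nat.lt_mul_div_succ m ht).le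
    · rw [← hcard]
      exact isLCC_repeatedLift hK0 e
    · rw [← hcard]
      exact isLTC_repeatedLift hK0 e
  · rintro K _ _ hcard n N - rfl L rfl
    have hK0 : (Fintype.card K : ZMod 2) = 0 :=
      card_cast_zmod_two ht (hcard.trans hk)
    -- The lift itself is the case of a single repetition, `R = Unit`.
    rw [← repeatedLift_prodUnique]
    refine ⟨?_, ?_, ?_⟩
    · have hlog : Real.logb 2 ((k ^ n : ℕ) : ℝ) = (t * n : ℕ) := by
        rw [hk, ← pow_mul, Nat.cast_pow, Nat.cast_ofNat, Real.logb_pow,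
          Real.logb_self_eq_one one_lt_two, mul_one]
      rw [hlog, hk]
      exact le_finrank_repeatedLift ht (hcard.trans hk) (Nat.mul_le_mul_left _ n.le_succ) _
    · rw [← hcard]
      exact isLCC_repeatedLift hK0 _
    · rw [← hcard]
      exact isLTC_repeatedLift hK0 _
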